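/- Let $G$ be a countable group and let $\mu$ be a probability measure on $G$ whose support generates $G$ as a semigroup; put $\check\mu(g)=\mu(g^{-1})$, which again is such a measure. An action of $G$ on a probability space $(X,\nu)$ by bi-measurable maps is *nonsingular* if every $g\in G$ preserves the measure class of $\nu$. A nonsingular action is *ergodic* if every measurable set $A$ with $\nu(g^{-1}A\,\triangle\,A)=0$ for all $g\in G$ is $\nu$-null or $\nu$-conull. For a probability measure $\lambda$ on $G$, a *$(G,\lambda)$-space* is a probability space $(X,\nu)$ with a nonsingular $G$-action such that $$\sum_{g\in G}\lambda(g)\int_X\varphi(g^{-1}x)\,d\nu(x)=\int_X\varphi\,d\nu\qquad\text{for all }\varphi\in L^\infty(X,\nu).$$ Let $\mathcal H^\infty_l(G,\lambda)$ be the space of bounded functions $f:G\to\mathbb C$ with $\check\lambda*f=f$, i.e. $f(g)=\sum_{s\in G}\check\lambda(s)f(s^{-1}g)$ for all $g\in G$, equipped with the supremum norm. A *Poisson boundary* of $(G,\lambda)$ is an ergodic $(G,\lambda)$-space $(B,m)$ for which the Poisson transform $$P\varphi(g)=\int_B\varphi(g^{-1}b)\,dm(b),\qquad g\in G,$$ is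 an isometric isomorphism of $L^\infty(B,m)$ onto $\mathcal H^\infty_l(G,\lambda)$. **Theorem (Kaimanovich, weak version).** Let $(B,m)$ and $(\check B,\check m)$ be Poisson boundaries of $(G,\mu)$ and $(G,\check\mu)$ respectively. Then: 1. for every ergodic probability-measure-preserving $G$-space $(Y,\eta)$, the diagonal action of $G$ on $(B\times\check B\times Y,\ m\otimes\check m\otimes\eta)$ is (nonsingular and) ergodic; 2. (the equivalent formulation: double ergodicity with unitary coefficients) for every complex Hilbert space $\mathcal H$, every unitary representation $\pi$ of $G$ on $\mathcal H$, and every $m\otimes\check m$-strongly measurable map $F:B\times\check B\to\mathcal H$ such that, for each $g\in G$, $F(gb,gb')=\pi(g)F(b,b')$ for $m\otimes\check m$-almost every $(b,b')$, the map $F$ is $m\otimes\check m$-almost everywhere equal to a constant. -/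

import Mathlib

open MeasureTheory Filter
open scoped ENNReal

namespace MeasuredGroup

/-- `(G, μ)` is a measured group: `G` is a countable group and `μ` is a probability measure on `G`
whose support generates `G` as a semigroup. -/
structure IsMeasuredGroup {G : Type*} [Group G] (μ : PMF G) : Prop where
  countable : Countable G
  closure_support : Subsemigroup.closure μ.support = ⊤

/-- The reflected probability measure, `g ↦ μ (g⁻¹)`. -/
noncomputable def reflect {G : Type*} [Group G] (μ : PMF G) : PMF G :=
  ⟨fun g => μ g⁻¹, (Equiv.inv G).hasSum_iff.mpr μ.2⟩

/-- The convolution `(μ * f)(g) = ∑ s, μ(s) f(s⁻¹ g)` of a probability measure and a function on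
`G`; the series converges absolutely when `f` is bounded. -/
noncomputable def convolve {G : Type*} [Group G] (μ : PMF G) (f : G → ℂ) (g : G) : ℂ :=
  ∑' s : G, ((μ s).toReal : ℂ) * f (s⁻¹ * g)

/-- Bounded left `μ`-harmonic functions: bounded `f : G → ℂ` with `reflect μ * f = f`. -/
structure IsBoundedLeftHarmonic {G : Type*} [Group G] (μ : PMF G) (f : G → ℂ) : Prop where
  bounded : ∃ C : ℝ, ∀ g, ‖f g‖ ≤ C
  harmonic : ∀ g, convolve (reflect μ) f g = f g

/-- The action of `G` on `(X, ν)` is nonsingular: `G` acts by bi-measurable maps, all of which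
preserve the measure class of `ν`. -/
structure IsNonsingularAction (G : Type*) {X : Type*} [Group G] [MulAction G X]
    [MeasurableSpace X] (ν : Measure X) : Prop where
  quasiMeasurePreserving : ∀ g : G, Measure.QuasiMeasurePreserving (fun x : X => g • x) ν ν

/-- Ergodicity of a nonsingular action: every (essentially) invariant measurable set is null or
conull. -/
structure IsErgodicAction (G : Type*) {X : Type*} [Group G] [MulAction G X]
    [MeasurableSpace X] (ν : Measure X) : Prop extends IsNonsingularAction G ν where
  eventuallyConst : ∀ s : Set X, MeasurableSet s →
    (∀ g : G, (fun x : X => g • x) ⁻¹' s =ᵐ[ν] s) → EventuallyConst s (ae ν)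

/-- `(X, ν)` is a `(G, μ)`-space: a probability space with a nonsingular `G`-action for which `ν`
is `μ`-harmonic, that is `∑ g, μ(g) ∫ φ(g⁻¹ x) dν(x) = ∫ φ dν` for all `φ` in `L^∞(X, ν)`. -/
structure IsHarmonicSpace {G X : Type*} [Group G] [MulAction G X] [MeasurableSpace X]
    (μ : PMF G) (ν : Measure X) : Prop extends IsNonsingularAction G ν where
  isProbabilityMeasure : IsProbabilityMeasure ν
  harmonic : ∀ φ : X → ℂ, MemLp φ ∞ ν →
    ∑' g : G, ((μ g).toReal : ℂ) * ∫ x, φ (g⁻¹ • x) ∂ν = ∫ x, φ x ∂ν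

/-- The Poisson transform `Pφ(g) = ∫ φ(g⁻¹ b) dm(b)`. -/
noncomputable def poissonTransform {G B : Type*} [Group G] [MulAction G B] [MeasurableSpace B]
    (m : Measure B) (φ : B → ℂ) (g : G) : ℂ :=
  ∫ b, φ (g⁻¹ • b) ∂m

/-- `(B, m)` is (a realization of) the Poisson boundary of `(G, μ)`: an ergodic `(G, μ)`-space for
which the Poisson transform is an isometric isomorphism of `L^∞(B, m)` onto the space of bounded
left `μ`-harmonic functions with the supremum norm. -/
structure IsPoissonBoundary {G B : Type*} [Group G] [MulAction G B] [MeasurableSpace B]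
    (μ : PMF G) (m : Measure B) : Prop where
  isHarmonicSpace : IsHarmonicSpace μ m
  isErgodicAction : IsErgodicAction G m
  harmonic : ∀ φ : B → ℂ, MemLp φ ∞ m →
    IsBoundedLeftHarmonic μ (poissonTransform (G := G) m φ)
  isometric : ∀ φ : B → ℂ, MemLp φ ∞ m →
    ⨆ g : G, ‖poissonTransform m φ g‖ₑ = eLpNorm φ ∞ m
  surjective : ∀ f : G → ℂ, IsBoundedLeftHarmonic μ f →
    ∃ φ : B → ℂ, MemLp φ ∞ m ∧ ∀ g : G, poissonTransform m φ g = f g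

end MeasuredGroup

namespace MeasuredGroup

/-! ### Second moments for a probability weight on a group -/

section Weights

variable {G H : Type*} [NormedAddCommGroup H] [InnerProductSpace ℂ H]

/-! For bounded equivariant `F`, put `f g = ∫∫ F(g⁻¹b, b')`. The boundary `B` makes `f` left
harmonic; equivariance moves the translation to `b'`, so `B'` makes `f` right harmonic up to a twist
by `π`. Such an `f` is constant (`eq_of_biharmonic`): the left variance `D` of `f` is the defect of
harmonicity of `‖f‖²` and is right subharmonic, and left and right averages agree at the identity,
so a nonzero `D` would make the averages of `‖f‖²` grow without bound. The constant is
`π`-invariant, and injectivity of the Poisson transform, applied on `B` and then on almost every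
fibre `B'`, gives `F` constant.

The scalar case applied to an invariant function of `‖F‖` removes the boundedness assumption.
Ergodicity of the triple product follows by viewing an invariant set as an equivariant map from `B ×
B'` into the Koopman representation on `L²(Y)`. -/

theorem hasSum_toReal (μ : PMF G) : HasSum (fun s => (μ s).toReal) 1 := by
  have h := (ENNReal.hasSum_toReal (f := μ) (by simp [μ.tsum_coe]))
  simpa [← ENNReal.tsum_toReal_eq (fun s => μ.apply_ne_top s), μ.tsum_coe] using h

theorem summable_toReal_smul [CompleteSpace H] (μ : PMF G) {w : G → H} {C : ℝ}
    (hw : ∀ s, ‖w s‖ ≤ C) : Summable (fun s => ((μ s).toReal : ℂ) • w s) := by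
  refine Summable.of_norm_bounded ((hasSum_toReal μ).summable.mul_right C) fun s => ?_
  rw [norm_smul, Complex.norm_real, Real.norm_of_nonneg ENNReal.toReal_nonneg]
  exact mul_le_mul_of_nonneg_left (hw s) ENNReal.toReal_nonneg

theorem enorm_sq_eq_ofReal {E : Type*} [SeminormedAddCommGroup E] (x : E) : ‖x‖ₑ ^ 2 = ENNReal.ofReal (‖x‖ ^ 2) := by
  rw [← ofReal_norm, ENNReal.ofReal_pow (norm_nonneg x)]

theorem tsum_mul_enorm_sq {E : Type*} [SeminormedAddCommGroup E] (μ : PMF G) {w : G → E} {C : ℝ} (hw : ∀ s, ‖w s‖ ≤ C) :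
    ∑' s, μ s * ‖w s‖ₑ ^ 2 = ENNReal.ofReal (∑' s, (μ s).toReal * ‖w s‖ ^ 2) ∧
      Summable (fun s => (μ s).toReal * ‖w s‖ ^ 2) := by
  have hS : Summable (fun s => (μ s).toReal * ‖w s‖ ^ 2) := by
    refine Summable.of_nonneg_of_le (fun s => by positivity) (fun s => ?_)
      ((hasSum_toReal μ).summable.mul_right (C ^ 2))
    have := hw s
    gcongr
  refine ⟨?_, hS⟩
  rw [ENNReal.ofReal_tsum_of_nonneg (fun s => by positivity) hS]
  refine tsum_congr fun s => ?_
  rw [ENNReal.ofReal_mul ENNReal.toReal_nonneg, ENNReal.ofReal_toReal (μ.apply_ne_top s),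
    enorm_sq_eq_ofReal]

/-- The second moment is the square of the mean plus the variance. -/
theorem tsum_enorm_sq_eq_add_variance (μ : PMF G) {w : G → H} {C : ℝ} (hw : ∀ s, ‖w s‖ ≤ C)
    {c : H} (hc : HasSum (fun s => ((μ s).toReal : ℂ) • w s) c) :
    ∑' s, μ s * ‖w s‖ₑ ^ 2 = ‖c‖ₑ ^ 2 + ∑' s, μ s * ‖w s - c‖ₑ ^ 2 := by
  have hw' : ∀ s, ‖w s - c‖ ≤ C + ‖c‖ := fun s =>
    (norm_sub_le _ _).trans (add_le_add_left (hw s) _)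
  obtain ⟨h1, hS1⟩ := tsum_mul_enorm_sq μ hw
  obtain ⟨h2, hS2⟩ := tsum_mul_enorm_sq μ hw'
  have h0 : 0 ≤ ∑' s, (μ s).toReal * ‖w s - c‖ ^ 2 := tsum_nonneg fun s => by positivity
  rw [h1, h2, enorm_sq_eq_ofReal, ← ENNReal.ofReal_add (by positivity) h0]
  congr 1
  have hin : HasSum (fun s => (μ s).toReal * RCLike.re (inner ℂ c (w s))) (‖c‖ ^ 2) := by
    have := (RCLike.hasSum_re ℂ ((innerSL ℂ c).hasSum hc))
    simpa [inner_self_eq_norm_sq_to_K, inner_smul_right, ← Complex.ofReal_pow] using this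
  have key : ∀ s, (μ s).toReal * ‖w s - c‖ ^ 2 = (μ s).toReal * ‖w s‖ ^ 2
      - 2 * ((μ s).toReal * RCLike.re (inner ℂ c (w s))) + (μ s).toReal * ‖c‖ ^ 2 := by
    intro s
    rw [norm_sub_rev, @norm_sub_sq ℂ]
    ring
  have hsum := ((hS1.hasSum.sub (hin.mul_left 2)).add ((hasSum_toReal μ).mul_right (‖c‖ ^ 2)))
  rw [tsum_congr key, hsum.tsum_eq]
  ring

end Weights

/-! ### Twisted biharmonic functions are constant -/

section Biharmonic

variable {G H : Type*} [Group G] [NormedAddCommGroup H] [InnerProductSpace ℂ H]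

/-- The transition operator `u ↦ (x ↦ ∑ t, μ(t) u(x t))` of the right random walk. -/
noncomputable def transition (μ : PMF G) (u : G → ℝ≥0∞) (x : G) : ℝ≥0∞ :=
  ∑' t, μ t * u (x * t)

theorem transition_mono (μ : PMF G) : Monotone (transition μ) := fun _ _ h x =>
  ENNReal.tsum_le_tsum fun t => by gcongr; exact h _

theorem transition_add (μ : PMF G) (u v : G → ℝ≥0∞) :
    transition μ (u + v) = transition μ u + transition μ v := by
  ext x
  simp [transition, mul_add, ENNReal.tsum_add]

theorem transition_iterate_add (μ : PMF G) (n : ℕ) (u v : G → ℝ≥0∞) :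
    (transition μ)^[n] (u + v) = (transition μ)^[n] u + (transition μ)^[n] v := by
  induction n generalizing u v with
  | zero => rfl
  | succ n ih => simp only [Function.iterate_succ_apply, transition_add, ih]

theorem transition_const (μ : PMF G) (C : ℝ≥0∞) :
    transition μ (fun _ => C) = fun _ => C := by
  ext x
  simp [transition, ENNReal.tsum_mul_right, μ.tsum_coe]

theorem transition_iterate_le (μ : PMF G) {u : G → ℝ≥0∞} {C : ℝ≥0∞} (h : ∀ x, u x ≤ C) (n : ℕ)
    (x : G) : (transition μ)^[n] u x ≤ C := by
  have h1 := (transition_mono μ).iterate n (show u ≤ fun _ => C from h) x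
  rwa [Function.iterate_fixed (transition_const μ C)] at h1

/-- Left and right translations commute, so left averaging commutes with the right random walk. -/
theorem transition_iterate_left_comm (μ : PMF G) (n : ℕ) (u : G → ℝ≥0∞) :
    (transition μ)^[n] (fun x => ∑' s, μ s * u (s * x)) =
      fun x => ∑' s, μ s * (transition μ)^[n] u (s * x) := by
  induction n generalizing u with
  | zero => rfl
  | succ n ih =>
    simp only [Function.iterate_succ_apply, ← ih]
    congr 1
    ext x
    simp only [transition, ← ENNReal.tsum_mul_left]
    rw [ENNReal.tsum_comm]
    simp only [mul_assoc, mul_left_comm]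

/-- Vanishing of all iterates passes from `y` to `y * t` for `t` in the support, hence along the
whole generated semigroup. -/
theorem eq_zero_of_transition_iterate_eq_zero {μ : PMF G}
    (hμ : Subsemigroup.closure (μ.support) = ⊤) {D : G → ℝ≥0∞}
    (h : ∀ n, (transition μ)^[n] D 1 = 0) (x : G) : D x = 0 := by
  have step : ∀ y, (∀ n, (transition μ)^[n] D y = 0) → ∀ t ∈ μ.support,
      ∀ n, (transition μ)^[n] D (y * t) = 0 := by
    intro y hy t ht n
    have := hy (n + 1)
    rw [Function.iterate_succ_apply', transition, ENNReal.tsum_eq_zero] at this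
    exact (mul_eq_zero.1 (this t)).resolve_left ((μ.mem_support_iff t).1 ht)
  have all : ∀ z ∈ Subsemigroup.closure μ.support, ∀ y, (∀ n, (transition μ)^[n] D y = 0) →
      ∀ n, (transition μ)^[n] D (y * z) = 0 := by
    intro z hz
    induction hz using Subsemigroup.closure_induction with
    | mem t ht => exact fun y hy => step y hy t ht
    | mul a b _ _ ha hb =>
      intro y hy
      rw [← mul_assoc]
      exact hb _ (ha y hy)
  simpa using all x (by simp [hμ]) 1 h 0

/-- A bounded function on `G` with values in a Hilbert space that is left harmonic, and right
harmonic up to a unitary twist, is constant. -/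
theorem eq_of_biharmonic {μ : PMF G} (hμ : Subsemigroup.closure (μ.support) = ⊤)
    (π : G → (H ≃ₗᵢ[ℂ] H)) {f : G → H} {C : ℝ} (hf : ∀ x, ‖f x‖ ≤ C)
    (hl : ∀ x, HasSum (fun s => ((μ s).toReal : ℂ) • f (s * x)) (f x))
    (hr : ∀ x, HasSum (fun t => ((μ t).toReal : ℂ) • π t (f (x * t))) (f x)) (g : G) :
    f g = f 1 := by
  set u : G → ℝ≥0∞ := fun x => ‖f x‖ₑ ^ 2 with hu
  set D : G → ℝ≥0∞ := fun x => ∑' s, μ s * ‖f (s * x) - f x‖ₑ ^ 2 with hD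
  have hLu : (fun x => ∑' s, μ s * u (s * x)) = u + D := by
    ext x
    exact tsum_enorm_sq_eq_add_variance μ (fun s => hf (s * x)) (hl x)
  -- For fixed `s`, the difference `f (s * x) - f x` is again twisted right harmonic in `x`;
  -- dropping its variance leaves an inequality, and `π t` is isometric.
  have hDT : D ≤ transition μ D := by
    intro x
    have hs : ∀ s, ‖f (s * x) - f x‖ₑ ^ 2 ≤ ∑' t, μ t * ‖f (s * (x * t)) - f (x * t)‖ₑ ^ 2 := by
      intro s
      have h1 : HasSum (fun t => ((μ t).toReal : ℂ) • π t (f (s * (x * t)) - f (x * t)))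
          (f (s * x) - f x) := by
        simpa [smul_sub, mul_assoc] using (hr (s * x)).sub (hr x)
      have h2 := tsum_enorm_sq_eq_add_variance μ (C := C + C) (fun t => by
        rw [LinearIsometryEquiv.norm_map]
        exact (norm_sub_le _ _).trans (add_le_add (hf _) (hf _))) h1
      simp only [LinearIsometryEquiv.enorm_map] at h2
      rw [h2]
      exact le_self_add
    calc D x ≤ ∑' s, μ s * ∑' t, μ t * ‖f (s * (x * t)) - f (x * t)‖ₑ ^ 2 :=
          ENNReal.tsum_le_tsum fun s => by gcongr; exact hs s
      _ = transition μ D x := by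
          simp only [transition, hD, ← ENNReal.tsum_mul_left]
          rw [ENNReal.tsum_comm]
          simp only [mul_left_comm]
  have hmono : ∀ n, (transition μ)^[n] D 1 ≤ (transition μ)^[n + 1] D 1 := fun n =>
    (transition_mono μ).iterate n hDT 1
  -- At `1` the left average of a function equals its right average, which turns the variance
  -- identity into a recursion in `n`.
  have hstep : ∀ n, (transition μ)^[n + 1] u 1
      = (transition μ)^[n] u 1 + (transition μ)^[n] D 1 := by
    intro n
    have h1 := congrFun (transition_iterate_left_comm μ n u) 1
    rw [hLu, transition_iterate_add] at h1
    rw [Function.iterate_succ_apply', transition]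
    simpa using h1.symm
  have hsum : ∀ n N : ℕ, (N : ℝ≥0∞) * (transition μ)^[n] D 1 ≤ (transition μ)^[n + N] u 1 := by
    intro n N
    induction N with
    | zero => simp
    | succ N ih =>
      rw [← add_assoc, hstep, Nat.cast_succ, add_mul, one_mul]
      refine add_le_add ih ?_
      exact monotone_nat_of_le_succ (f := fun k => (transition μ)^[k] D 1) hmono
        (Nat.le_add_right n N)
  have huC : ∀ x, u x ≤ ENNReal.ofReal (C ^ 2) := fun x => by
    refine (enorm_sq_eq_ofReal (f x)).trans_le ?_
    exact ENNReal.ofReal_le_ofReal (pow_le_pow_left₀ (norm_nonneg _) (hf x) 2)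
  have hzero : ∀ n, (transition μ)^[n] D 1 = 0 := by
    intro n
    by_contra hne
    obtain ⟨N, hN⟩ := ENNReal.exists_nat_mul_gt hne (ENNReal.ofReal_ne_top (r := C ^ 2))
    exact absurd ((hsum n N).trans (transition_iterate_le μ huC _ _)) (not_le.2 hN)
  have hD0 := eq_zero_of_transition_iterate_eq_zero hμ hzero
  have hinv : ∀ z ∈ Subsemigroup.closure μ.support, ∀ x, f (z * x) = f x := by
    intro z hz
    induction hz using Subsemigroup.closure_induction with
    | mem t ht =>
      intro x
      have := (mul_eq_zero.1 (ENNReal.tsum_eq_zero.1 (hD0 x) t)).resolve_left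
        ((μ.mem_support_iff t).1 ht)
      simpa [sub_eq_zero] using this
    | mul a b _ _ ha hb =>
      intro x
      rw [mul_assoc, ha, hb]
  simpa using hinv g (by simp [hμ]) 1

/-- A vector that is the `μ`-average of its translates under a unitary representation is
invariant. -/
theorem map_eq_of_hasSum {μ : PMF G} (hμ : Subsemigroup.closure (μ.support) = ⊤)
    (π : G →* (H ≃ₗᵢ[ℂ] H)) {c : H}
    (hc : HasSum (fun t => ((μ t).toReal : ℂ) • π t c) c) (g : G) : π g c = c := by
  have hvar := tsum_enorm_sq_eq_add_variance μ (C := ‖c‖) (fun t => by simp) hc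
  simp only [LinearIsometryEquiv.enorm_map, ENNReal.tsum_mul_right, μ.tsum_coe, one_mul] at hvar
  have h0 : ∑' t, μ t * ‖π t c - c‖ₑ ^ 2 = 0 := by
    have hfin : ‖c‖ₑ ^ 2 ≠ ∞ := ENNReal.pow_ne_top enorm_ne_top
    exact (ENNReal.add_right_inj hfin).1 (by rw [← hvar, add_zero])
  have hg : g ∈ Subsemigroup.closure μ.support := by simp [hμ]
  induction hg using Subsemigroup.closure_induction with
  | mem t ht =>
    have := (mul_eq_zero.1 (ENNReal.tsum_eq_zero.1 h0 t)).resolve_left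
      ((μ.mem_support_iff t).1 ht)
    simpa [sub_eq_zero] using this
  | mul a b _ _ ha hb => rw [map_mul, LinearIsometryEquiv.coe_mul, Function.comp_apply, hb, ha]

end Biharmonic

/-! ### Poisson transforms of Hilbert- and Banach-valued functions -/

section Poisson

variable {G B E : Type*} [Group G] [MulAction G B] [MeasurableSpace B]
  [NormedAddCommGroup E] [NormedSpace ℂ E] {μ : PMF G} {m : Measure B}

theorem IsPoissonBoundary.quasiMeasurePreserving (hm : IsPoissonBoundary μ m) (g : G) :
    Measure.QuasiMeasurePreserving (fun b : B => g • b) m m :=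
  hm.isErgodicAction.quasiMeasurePreserving g

theorem IsPoissonBoundary.memLp_smul {E : Type*} [NormedAddCommGroup E]
    (hm : IsPoissonBoundary μ m) {ψ : B → E} (hψ : MemLp ψ ∞ m)
    (g : G) : MemLp (fun b => ψ (g • b)) ∞ m := by
  refine memLp_top_of_bound (C := (eLpNormEssSup ψ m).toReal)
    (hψ.1.comp_quasiMeasurePreserving (hm.quasiMeasurePreserving g)) ?_
  refine (hm.quasiMeasurePreserving g).ae (p := fun b => ‖ψ b‖ ≤ (eLpNormEssSup ψ m).toReal) ?_
  filter_upwards [ae_le_eLpNormEssSup (f := ψ) (μ := m)] with b hb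
  rw [← toReal_enorm]
  exact ENNReal.toReal_mono (by simpa using hψ.2.ne) hb

theorem memLp_dual {ψ : B → E} (hψ : MemLp ψ ∞ m) (ℓ : StrongDual ℂ E) :
    MemLp (fun b => ℓ (ψ b)) ∞ m :=
  ℓ.comp_memLp' hψ

variable [CompleteSpace E]

/-- A functional of the Poisson transform of a vector-valued function is the Poisson transform of
the functional of the function. -/
theorem IsPoissonBoundary.poissonTransform_dual (hm : IsPoissonBoundary μ m) {ψ : B → E}
    (hψ : MemLp ψ ∞ m) (ℓ : StrongDual ℂ E) (g : G) :
    poissonTransform m (fun b => ℓ (ψ b)) g = ℓ (∫ b, ψ (g⁻¹ • b) ∂m) := by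
  have := hm.isHarmonicSpace.isProbabilityMeasure
  exact ℓ.integral_comp_comm ((hm.memLp_smul hψ g⁻¹).integrable le_top)

/-- Poisson transforms of bounded vector-valued functions are harmonic. -/
theorem IsPoissonBoundary.hasSum_integral (hm : IsPoissonBoundary μ m) {ψ : B → E}
    (hψ : MemLp ψ ∞ m) (g : G)
    (hs : Summable fun s => ((μ s).toReal : ℂ) • ∫ b, ψ ((s * g)⁻¹ • b) ∂m) :
    HasSum (fun s => ((μ s).toReal : ℂ) • ∫ b, ψ ((s * g)⁻¹ • b) ∂m) (∫ b, ψ (g⁻¹ • b) ∂m) := by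
  convert hs.hasSum using 1
  refine (SeparatingDual.eq_iff_forall_dual_eq (R := ℂ)).2 fun ℓ => ?_
  rw [ℓ.map_tsum hs, ← hm.poissonTransform_dual hψ,
    ← (hm.harmonic _ (memLp_dual hψ ℓ)).harmonic g, convolve, ← (Equiv.inv G).tsum_eq]
  refine tsum_congr fun s => ?_
  have hr : reflect μ s⁻¹ = μ s := congrArg μ (inv_inv s)
  rw [Equiv.inv_apply, inv_inv, hr, hm.poissonTransform_dual hψ, map_smul, smul_eq_mul]

/-- A bounded vector-valued function with constant Poisson transform is constant. -/
theorem IsPoissonBoundary.ae_eq_const (hm : IsPoissonBoundary μ m) {ψ : B → E}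
    (hψ : MemLp ψ ∞ m) {c : E} (hc : ∀ g : G, ∫ b, ψ (g⁻¹ • b) ∂m = c) : ∀ᵐ b ∂m, ψ b = c := by
  have := hm.isHarmonicSpace.isProbabilityMeasure
  have hd : MemLp (fun b => ψ b - c) ∞ m := hψ.sub (memLp_const c)
  obtain ⟨t, ht, h't⟩ := hd.1.isSeparable_ae_range
  have hz : (fun b => ψ b - c) =ᵐ[m] 0 := by
    -- The essential range is separable, so it suffices to test on functionals, where the scalar
    -- isometry applies.
    refine ae_eq_zero_of_forall_dual_of_isSeparable ℂ ht (fun ℓ => ?_) h't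
    have hℓ := memLp_dual hd ℓ
    rw [← eLpNorm_eq_zero_iff hℓ.1 ENNReal.top_ne_zero, ← hm.isometric _ hℓ]
    refine ENNReal.iSup_eq_zero.2 fun g => ?_
    rw [hm.poissonTransform_dual hd, integral_sub ((hm.memLp_smul hψ g⁻¹).integrable le_top)
      (integrable_const c), hc g]
    simp
  filter_upwards [hz] with b hb
  exact sub_eq_zero.1 hb

end Poisson

/-! ### Double ergodicity with unitary coefficients -/

section DoubleErgodicity

variable {G B B' H : Type*} [Group G] [MulAction G B] [MeasurableSpace B] [MulAction G B']
  [MeasurableSpace B'] [NormedAddCommGroup H] [InnerProductSpace ℂ H] [CompleteSpace H]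
  {μ : PMF G} {m : Measure B} {m' : Measure B'}

/-- Double ergodicity with unitary coefficients, for bounded maps. -/
theorem ae_eq_const_of_equivariant_of_bounded (hμ : IsMeasuredGroup μ)
    (hm : IsPoissonBoundary μ m) (hm' : IsPoissonBoundary (reflect μ) m')
    (π : G →* (H ≃ₗᵢ[ℂ] H)) {F : B × B' → H} (hF : StronglyMeasurable F) {C : ℝ}
    (hC : ∀ᵐ p ∂(m.prod m'), ‖F p‖ ≤ C)
    (hπ : ∀ g : G, ∀ᵐ p ∂(m.prod m'), F (g • p) = π g (F p)) :
    ∃ c : H, ∀ᵐ p ∂(m.prod m'), F p = c := by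
  have := hμ.countable
  have := hm.isHarmonicSpace.isProbabilityMeasure
  have := hm'.isHarmonicSpace.isProbabilityMeasure
  have hq : ∀ a b : G, Measure.QuasiMeasurePreserving (fun p : B × B' => (a • p.1, b • p.2))
      (m.prod m') (m.prod m') := fun a b =>
    QuasiMeasurePreserving.prodMap (hm.quasiMeasurePreserving a) (hm'.quasiMeasurePreserving b)
  have hint : ∀ a b : G, Integrable (fun p : B × B' => F (a • p.1, b • p.2)) (m.prod m') := by
    intro a b
    exact Integrable.of_bound (hF.aestronglyMeasurable.comp_quasiMeasurePreserving (hq a b)) C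
      ((hq a b).ae hC)
  have htr : ∀ a b g : G, ∀ᵐ p ∂(m.prod m'),
      F ((g * a) • p.1, (g * b) • p.2) = π g (F (a • p.1, b • p.2)) := by
    intro a b g
    simpa [mul_smul] using (hq a b).ae (hπ g)
  have hCC : ∀ᵐ b ∂m, ∀ᵐ b' ∂m', ‖F (b, b')‖ ≤ C := Measure.ae_ae_of_ae_prod hC
  have hCC' : ∀ᵐ b' ∂m', ∀ᵐ b ∂m, ‖F (b, b')‖ ≤ C :=
    Measure.ae_ae_of_ae_prod (Measure.measurePreserving_swap.quasiMeasurePreserving.ae hC)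
  have hψ : MemLp (fun b => ∫ b', F (b, b') ∂m') ∞ m := by
    refine memLp_top_of_bound hF.integral_prod_right'.aestronglyMeasurable C ?_
    filter_upwards [hCC] with b hb
    simpa using norm_integral_le_of_norm_le_const hb
  have hψ' : MemLp (fun b' => ∫ b, F (b, b') ∂m) ∞ m' := by
    refine memLp_top_of_bound hF.integral_prod_left'.aestronglyMeasurable C ?_
    filter_upwards [hCC'] with b' hb'
    simpa using norm_integral_le_of_norm_le_const hb'
  set f : G → H := fun g => ∫ p, F (g⁻¹ • p.1, p.2) ∂(m.prod m') with hf
  have hfψ : ∀ g, ∫ b, ∫ b', F (g⁻¹ • b, b') ∂m' ∂m = f g := fun g =>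
    (integral_prod _ (by simpa using hint g⁻¹ 1)).symm
  have hfψ' : ∀ g, ∫ b', ∫ b, F (b, g • b') ∂m ∂m' = π g (f g) := by
    intro g
    rw [← integral_prod_symm (fun p : B × B' => F (p.1, g • p.2)) (by simpa using hint 1 g)]
    refine Eq.trans (integral_congr_ae ?_)
      ((π g).toContinuousLinearEquiv.toContinuousLinearMap.integral_comp_comm
        (by simpa using hint g⁻¹ 1))
    have h1 := htr g⁻¹ 1 g
    simp only [mul_inv_cancel, one_smul, mul_one] at h1
    exact h1
  have hfC : ∀ g, ‖f g‖ ≤ C := fun g => by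
    have := norm_integral_le_of_norm_le_const
      (f := fun p : B × B' => F (g⁻¹ • p.1, p.2)) (by simpa using (hq g⁻¹ 1).ae hC)
    rwa [probReal_univ, mul_one] at this
  have hl : ∀ x, HasSum (fun s => ((μ s).toReal : ℂ) • f (s * x)) (f x) := by
    intro x
    have := hm.hasSum_integral hψ x
    simp only [hfψ] at this
    exact this (summable_toReal_smul μ fun s => hfC _)
  have hr : ∀ x, HasSum (fun t => ((μ t).toReal : ℂ) • π t (f (x * t))) (f x) := by
    intro x
    have h1 := hm'.hasSum_integral hψ' x⁻¹
    -- Reindexed by `s = t⁻¹`, this reads `∑ μ(t) π(xt) f(xt) = π(x) f(x)`; applying `π x⁻¹` gives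
    -- the claim.
    simp only [mul_inv_rev, inv_inv, hfψ'] at h1
    have h2 := (Equiv.inv G).hasSum_iff.2 (h1 (summable_toReal_smul _ (C := C) fun s => by
      simpa using hfC _))
    have h3 := (π x⁻¹).toContinuousLinearEquiv.toContinuousLinearMap.hasSum h2
    have h4 : ∀ t, reflect μ t⁻¹ = μ t := fun t => congrArg μ (inv_inv t)
    have h5 : ∀ t v, π x⁻¹ (π (x * t) v) = π t v := fun t v => by
      rw [← Function.comp_apply (f := π x⁻¹), ← LinearIsometryEquiv.coe_mul, ← map_mul,
        inv_mul_cancel_left]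
    have h6 : ∀ v, π x⁻¹ (π x v) = v := fun v => by simp
    convert h3 using 1
    · ext t
      simp only [Function.comp_apply, Equiv.inv_apply, inv_inv, h4]
      refine Eq.trans ?_ ((π x⁻¹).map_smul _ _).symm
      rw [h5]
    · exact (h6 _).symm
  have hconst := eq_of_biharmonic hμ.closure_support π hfC hl hr
  set c := f 1
  have hπc : ∀ g, π g c = c := by
    refine map_eq_of_hasSum hμ.closure_support π ?_
    simpa only [hconst] using hr 1
  refine ⟨c, ?_⟩
  have hψc : ∀ᵐ b ∂m, ∫ b', F (b, b') ∂m' = c :=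
    hm.ae_eq_const hψ fun g => (hfψ g).trans (hconst g)
  -- Since `F(b, g⁻¹b') = π(g⁻¹) F(gb, b')`, integrating in `b'` gives `π(g⁻¹) c = c`. Thus `F(b,
  -- ·)` has constant Poisson transform on `B'`.
  have hall : ∀ᵐ b ∂m, ∀ g : G, ∫ b', F (b, g⁻¹ • b') ∂m' = c := by
    refine ae_all_iff.2 fun g => ?_
    have h1 := Measure.ae_ae_of_ae_prod (htr g 1 g⁻¹)
    filter_upwards [h1, (hm.quasiMeasurePreserving g).ae hψc,
      (hm.quasiMeasurePreserving g).ae hCC] with b hb hgb hCb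
    simp only [inv_mul_cancel, one_smul, mul_one] at hb
    have hi : Integrable (fun b' => F (g • b, b')) m' := Integrable.of_bound
      (hF.comp_measurable measurable_prodMk_left).aestronglyMeasurable C hCb
    rw [integral_congr_ae hb, ← hπc g⁻¹, ← hgb]
    exact (π g⁻¹).toContinuousLinearEquiv.toContinuousLinearMap.integral_comp_comm hi
  have hmeas : MeasurableSet {p | F p = c} :=
    hF.measurableSet_eq_fun stronglyMeasurable_const
  refine (Measure.ae_prod_iff_ae_ae hmeas).2 ?_
  filter_upwards [hall, hCC] with b hb hCb
  exact hm'.ae_eq_const (memLp_top_of_bound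
    (hF.comp_measurable measurable_prodMk_left).aestronglyMeasurable C hCb) hb

theorem IsPoissonBoundary.quasiMeasurePreserving_prod (hm : IsPoissonBoundary μ m) {ν : PMF G}
    (hm' : IsPoissonBoundary ν m') (g : G) :
    Measure.QuasiMeasurePreserving (fun p : B × B' => g • p) (m.prod m') (m.prod m') :=
  have := hm.isHarmonicSpace.isProbabilityMeasure
  have := hm'.isHarmonicSpace.isProbabilityMeasure
  QuasiMeasurePreserving.prodMap (hm.quasiMeasurePreserving g) (hm'.quasiMeasurePreserving g)

omit [CompleteSpace H] in
/-- The norm of an equivariant map into a unitary representation is almost everywhere bounded. -/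
theorem ae_norm_le_of_equivariant (hμ : IsMeasuredGroup μ)
    (hm : IsPoissonBoundary μ m) (hm' : IsPoissonBoundary (reflect μ) m')
    (π : G →* (H ≃ₗᵢ[ℂ] H)) {F : B × B' → H} (hF : StronglyMeasurable F)
    (hπ : ∀ g : G, ∀ᵐ p ∂(m.prod m'), F (g • p) = π g (F p)) :
    ∃ C : ℝ, ∀ᵐ p ∂(m.prod m'), ‖F p‖ ≤ C := by
  -- A bounded invariant function that determines `‖F‖`; the bounded case with trivial
  -- representation makes it constant.
  set u : B × B' → ℂ := fun p => (((1 + ‖F p‖)⁻¹ : ℝ) : ℂ) with hu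
  have hum : StronglyMeasurable u := by
    have : Measurable u := Complex.measurable_ofReal.comp (hF.norm.measurable.const_add 1).inv
    exact this.stronglyMeasurable
  obtain ⟨c, hc⟩ := ae_eq_const_of_equivariant_of_bounded hμ hm hm' (1 : G →* (ℂ ≃ₗᵢ[ℂ] ℂ)) hum
    (C := 1) (Eventually.of_forall fun p => by
      rw [hu, Complex.norm_real, Real.norm_of_nonneg (by positivity)]
      exact inv_le_one_of_one_le₀ (by linarith [norm_nonneg (F p)]))
    (fun g => by
      filter_upwards [hπ g] with p hp
      simp [hu, hp])
  refine ⟨c.re⁻¹, ?_⟩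
  filter_upwards [hc] with p hp
  rw [← hp, hu, Complex.ofReal_re, inv_inv]
  linarith

/-- Double ergodicity with unitary coefficients. -/
theorem ae_eq_const_of_equivariant (hμ : IsMeasuredGroup μ)
    (hm : IsPoissonBoundary μ m) (hm' : IsPoissonBoundary (reflect μ) m')
    (π : G →* (H ≃ₗᵢ[ℂ] H)) {F : B × B' → H} (hF : AEStronglyMeasurable F (m.prod m'))
    (hπ : ∀ g : G, ∀ᵐ p ∂(m.prod m'), F (g • p) = π g (F p)) :
    ∃ c : H, ∀ᵐ p ∂(m.prod m'), F p = c := by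
  have hπ' : ∀ g : G, ∀ᵐ p ∂(m.prod m'), hF.mk F (g • p) = π g (hF.mk F p) := by
    intro g
    filter_upwards [hπ g, hF.ae_eq_mk, (hm.quasiMeasurePreserving_prod hm' g).ae hF.ae_eq_mk]
      with p h1 h2 h3
    rw [← h2, ← h3, h1]
  obtain ⟨C, hC⟩ := ae_norm_le_of_equivariant hμ hm hm' π hF.stronglyMeasurable_mk hπ'
  obtain ⟨c, hc⟩ :=
    ae_eq_const_of_equivariant_of_bounded hμ hm hm' π hF.stronglyMeasurable_mk hC hπ'
  refine ⟨c, ?_⟩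
  filter_upwards [hc, hF.ae_eq_mk] with p h1 h2
  rw [h2, h1]

end DoubleErgodicity

/-! ### The Koopman representation -/

section Koopman

variable (G : Type*) {Y : Type*} [Group G] [MulAction G Y] [MeasurableSpace Y]
  [MeasurableConstSMul G Y]

/-- The Koopman representation on `L²` of a measure-preserving action. -/
noncomputable def koopman (η : Measure Y) [SMulInvariantMeasure G Y η] :
    G →* (Lp ℂ 2 η ≃ₗᵢ[ℂ] Lp ℂ 2 η) :=
  have hcomp : ∀ (a b : G) (u : Lp ℂ 2 η),
      Lp.compMeasurePreserving _ (measurePreserving_smul b η)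
        (Lp.compMeasurePreserving _ (measurePreserving_smul a η) u) =
      Lp.compMeasurePreserving _ (measurePreserving_smul (a * b) η) u := by
    intro a b u
    rw [← Lp.compMeasurePreserving_comp_apply]
    congr 2
    ext y
    simp [mul_smul]
  have hone : ∀ u : Lp ℂ 2 η,
      Lp.compMeasurePreserving _ (measurePreserving_smul (1 : G) η) u = u := by
    intro u
    conv_rhs => rw [← Lp.compMeasurePreserving_id_apply u]
    congr 2
    ext y
    simp
  -- Precomposition reverses products; using `g⁻¹` restores the order.
  { toFun := fun g =>
      { (Lp.compMeasurePreservingₗᵢ ℂ _ (measurePreserving_smul g⁻¹ η)) with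
        invFun := Lp.compMeasurePreserving _ (measurePreserving_smul g η)
        left_inv := fun u => (hcomp _ _ u).trans (by simpa using hone u)
        right_inv := fun u => (hcomp _ _ u).trans (by simpa using hone u) }
    map_one' := by
      ext1 u
      refine Eq.trans ?_ (hone u)
      simp only [inv_one]
      rfl
    map_mul' := fun a b => by
      ext1 u
      refine Eq.trans ?_ (hcomp b⁻¹ a⁻¹ u).symm
      simp only [mul_inv_rev]
      rfl }

variable {G} in
theorem koopman_apply {η : Measure Y} [SMulInvariantMeasure G Y η] (g : G) (u : Lp ℂ 2 η) :
    koopman G η g u = Lp.compMeasurePreserving _ (measurePreserving_smul g⁻¹ η) u := rfl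

end Koopman

/-! ### Sections of a measurable set as vectors in `L²` -/

section Section

variable {X Y : Type*} [MeasurableSpace X] [MeasurableSpace Y]

/-- The map sending `x` to the class in `L²(Y)` of the indicator of the `x`-section of `A`. -/
noncomputable def sectionIndicator (η : Measure Y) [IsFiniteMeasure η] {A : Set (X × Y)}
    (hA : MeasurableSet A) (x : X) : Lp ℂ 2 η :=
  indicatorConstLp 2 (measurable_prodMk_left hA : MeasurableSet (Prod.mk x ⁻¹' A))
    (measure_ne_top η _) 1

theorem sectionIndicator_eq_iff {η : Measure Y} [IsFiniteMeasure η] {A : Set (X × Y)}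
    (hA : MeasurableSet A) (x : X) {S : Set Y} (hS : MeasurableSet S) :
    sectionIndicator η hA x = indicatorConstLp 2 hS (measure_ne_top η _) 1 ↔
      Prod.mk x ⁻¹' A =ᵐ[η] S :=
  indicatorConstLp_inj _ _ _ _ one_ne_zero

theorem sectionIndicator_union (η : Measure Y) [IsFiniteMeasure η] {A A' : Set (X × Y)}
    (hA : MeasurableSet A) (hA' : MeasurableSet A') (hd : Disjoint A A') (x : X) :
    sectionIndicator η (hA.union hA') x = sectionIndicator η hA x + sectionIndicator η hA' x :=
  indicatorConstLp_disjoint_union _ _ _ _ (hd.preimage _) _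

/-- A π-λ argument from rectangles, with limits taken in `L²`; it needs no separability of `L²(Y)`.
-/
theorem stronglyMeasurable_sectionIndicator (η : Measure Y) [IsFiniteMeasure η] {A : Set (X × Y)}
    (hA : MeasurableSet A) : StronglyMeasurable (sectionIndicator η hA) := by
  induction A, hA using MeasurableSpace.induction_on_inter generateFrom_prod.symm
    isPiSystem_prod with
  | empty =>
    convert stronglyMeasurable_const (b := (0 : Lp ℂ 2 η)) using 1
    ext1 x
    exact indicatorConstLp_empty
  | basic t ht =>
    obtain ⟨s, hs, r, hr, rfl⟩ := ht
    convert (stronglyMeasurable_const (b := indicatorConstLp 2 hr (measure_ne_top η _) (1 : ℂ))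
      ).indicator hs using 1
    ext1 x
    by_cases hx : x ∈ s
    · rw [Set.indicator_of_mem hx, sectionIndicator_eq_iff, Set.mk_preimage_prod_right hx]
      exact ae_eq_rfl
    · rw [Set.indicator_of_notMem hx, ← indicatorConstLp_empty, sectionIndicator_eq_iff,
        Set.mk_preimage_prod_right_eq_empty hx]
      exact ae_eq_rfl
  | compl t ht ih =>
    convert (stronglyMeasurable_const (b := indicatorConstLp 2 MeasurableSet.univ
      (measure_ne_top η _) (1 : ℂ))).sub ih using 1
    ext1 x
    rw [Pi.sub_apply, eq_sub_iff_add_eq,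
      ← sectionIndicator_union η ht.compl ht disjoint_compl_left, sectionIndicator_eq_iff,
      Set.compl_union_self, Set.preimage_univ]
    exact ae_eq_rfl
  | iUnion s hd hs ih =>
    have hU : ∀ n, MeasurableSet (⋃ i < n, s i) := fun n =>
      MeasurableSet.iUnion fun i => MeasurableSet.iUnion fun _ => hs i
    have hUm : ∀ n, StronglyMeasurable (sectionIndicator η (hU n)) := by
      intro n
      induction n with
      | zero =>
        convert stronglyMeasurable_const (b := (0 : Lp ℂ 2 η)) using 1
        ext1 x
        rw [← indicatorConstLp_empty, sectionIndicator_eq_iff]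
        simp
      | succ n ihn =>
        convert ihn.add (ih n) using 1
        ext1 x
        have hdis : Disjoint (⋃ i < n, s i) (s n) := by
          simp only [Set.disjoint_iUnion_left]
          exact fun i hi => hd hi.ne
        rw [Pi.add_apply, ← sectionIndicator_union η _ _ hdis]
        refine (sectionIndicator_eq_iff _ _ _).2 ?_
        rw [Set.biUnion_lt_succ]
        exact ae_eq_rfl
    refine stronglyMeasurable_of_tendsto atTop hUm (tendsto_pi_nhds.2 fun x => ?_)
    refine tendsto_indicatorConstLp_set ENNReal.ofNat_ne_top ?_
    have hmono : Monotone fun n => ⋃ i < n, s i := fun a b hab =>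
      Set.biUnion_subset_biUnion_left fun i hi => lt_of_lt_of_le hi hab
    have hsub : ∀ n, (⋃ i < n, s i) ⊆ ⋃ i, s i := fun n => by
      simp only [Set.iUnion_subset_iff]
      exact fun i _ => Set.subset_iUnion s i
    have hlim := tendsto_measure_iInter_atTop (μ := η)
      (s := fun n => Prod.mk x ⁻¹' ((⋃ i, s i) \ ⋃ i < n, s i))
      (fun n => (measurable_prodMk_left
        ((MeasurableSet.iUnion hs).diff (hU n))).nullMeasurableSet)
      (fun a b hab => Set.preimage_mono (Set.sdiff_subset_sdiff_right (hmono hab)))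
      ⟨0, measure_ne_top _ _⟩
    have hempty : ⋂ n, Prod.mk x ⁻¹' ((⋃ i, s i) \ ⋃ i < n, s i) = ∅ := by
      ext y
      simp only [Set.mem_iInter, Set.mem_preimage, Set.mem_sdiff, Set.mem_iUnion,
        Set.mem_empty_iff_false, iff_false, not_forall, not_and, not_not]
      by_cases h : ∃ i, (x, y) ∈ s i
      · obtain ⟨i, hi⟩ := h
        exact ⟨i + 1, fun _ => ⟨i, Nat.lt_succ_self i, hi⟩⟩
      · exact ⟨0, fun h' => absurd h' h⟩
    rw [hempty, measure_empty] at hlim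
    refine hlim.congr fun n => ?_
    rw [← Set.preimage_symmDiff, symmDiff_of_le (hsub n)]
    rfl

end Section

/-! ### Ergodicity of the triple product -/

section Product

variable {G B B' Y : Type*} [Group G] [MulAction G B] [MeasurableSpace B] [MulAction G B']
  [MeasurableSpace B'] [MulAction G Y] [MeasurableSpace Y] [MeasurableConstSMul G Y]
  {μ : PMF G} {m : Measure B} {m' : Measure B'}

/-- The section map of `A` is Koopman-equivariant, hence essentially constant; the common section is
an invariant subset of `Y`, so null or conull. -/
theorem eventuallyConst_of_preimage_smul_ae_eq (hμ : IsMeasuredGroup μ)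
    (hm : IsPoissonBoundary μ m) (hm' : IsPoissonBoundary (reflect μ) m')
    (η : Measure Y) [IsProbabilityMeasure η] [ErgodicSMul G Y η] {A : Set ((B × B') × Y)}
    (hA : MeasurableSet A)
    (hinv : ∀ g : G, ∀ᵐ z ∂((m.prod m').prod η), g • z ∈ A ↔ z ∈ A) :
    (∀ᵐ z ∂((m.prod m').prod η), z ∈ A) ∨ ∀ᵐ z ∂((m.prod m').prod η), z ∉ A := by
  have := hμ.countable
  have := hm.isHarmonicSpace.isProbabilityMeasure
  have := hm'.isHarmonicSpace.isProbabilityMeasure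
  have hπ : ∀ g : G, ∀ᵐ p ∂(m.prod m'),
      sectionIndicator η hA (g • p) = koopman G η g (sectionIndicator η hA p) := by
    intro g
    filter_upwards [Measure.ae_ae_of_ae_prod (hinv g)] with p hp
    rw [koopman_apply, sectionIndicator, sectionIndicator,
      Lp.indicatorConstLp_compMeasurePreserving]
    refine (sectionIndicator_eq_iff hA _ _).2 (eventuallyEq_set.2 ?_)
    filter_upwards [(measurePreserving_smul g⁻¹ η).quasiMeasurePreserving.ae hp] with y hy
    simpa using hy
  obtain ⟨c, hc⟩ := ae_eq_const_of_equivariant hμ hm hm' (koopman G η)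
    (stronglyMeasurable_sectionIndicator η hA).aestronglyMeasurable hπ
  -- Countability of `G` gives one point `p` good for all `g` at once; its section represents `c` by
  -- a genuine set.
  obtain ⟨p, hp, hpg⟩ := (hc.and (ae_all_iff.2 fun g =>
    (hπ g).and ((hm.quasiMeasurePreserving_prod hm' g).ae hc))).exists
  have hSm : MeasurableSet (Prod.mk p ⁻¹' A) := measurable_prodMk_left hA
  have hS : ∀ g : G, (g • ·) ⁻¹' (Prod.mk p ⁻¹' A) =ᵐ[η] Prod.mk p ⁻¹' A := by
    intro g
    have h1 := (hpg g⁻¹).1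
    rw [(hpg g⁻¹).2, ← hp, koopman_apply, sectionIndicator,
      Lp.indicatorConstLp_compMeasurePreserving,
      indicatorConstLp_inj _ _ _ _ one_ne_zero] at h1
    simpa using h1.symm
  have hsec : ∀ᵐ q ∂(m.prod m'), Prod.mk q ⁻¹' A =ᵐ[η] Prod.mk p ⁻¹' A := by
    filter_upwards [hc] with q hq
    exact (sectionIndicator_eq_iff hA q hSm).1 (hq.trans hp.symm)
  rcases eventuallyConst_set'.1
    (ErgodicSMul.aeconst_of_forall_preimage_smul_ae_eq hSm hS) with h | h
  · right
    refine (Measure.ae_prod_mem_iff_ae_ae_mem hA.compl).2 ?_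
    filter_upwards [hsec] with q hq
    filter_upwards [eventuallyEq_set.1 (hq.trans h)] with y hy
    simpa using hy
  · left
    refine (Measure.ae_prod_mem_iff_ae_ae_mem hA).2 ?_
    filter_upwards [hsec] with q hq
    filter_upwards [eventuallyEq_set.1 (hq.trans h)] with y hy
    simpa using hy

/-- The product of the Poisson boundaries and an ergodic probability-measure-preserving space is
ergodic. -/
theorem isErgodicAction_prod (hμ : IsMeasuredGroup μ)
    (hm : IsPoissonBoundary μ m) (hm' : IsPoissonBoundary (reflect μ) m')
    (η : Measure Y) [IsProbabilityMeasure η] [ErgodicSMul G Y η] :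
    IsErgodicAction G (m.prod (m'.prod η)) := by
  have := hm.isHarmonicSpace.isProbabilityMeasure
  have := hm'.isHarmonicSpace.isProbabilityMeasure
  refine ⟨⟨fun g => ?_⟩, fun s hs hinv => ?_⟩
  · exact QuasiMeasurePreserving.prodMap (hm.quasiMeasurePreserving g)
      (QuasiMeasurePreserving.prodMap (hm'.quasiMeasurePreserving g)
        (measurePreserving_smul g η).quasiMeasurePreserving)
  have hassoc := measurePreserving_prodAssoc m m' η
  have h := eventuallyConst_of_preimage_smul_ae_eq hμ hm hm' η (hassoc.measurable hs)
    fun g => hassoc.quasiMeasurePreserving.ae (eventuallyEq_set.1 (hinv g))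
  have hsymm := (hassoc.symm MeasurableEquiv.prodAssoc).quasiMeasurePreserving
  rcases h with h | h
  · refine eventuallyConst_set'.2 (Or.inr (eventuallyEq_univ.2 ?_))
    filter_upwards [hsymm.ae h] with z hz
    simpa using hz
  · refine eventuallyConst_set'.2 (Or.inl (eventuallyEq_empty.2 ?_))
    filter_upwards [hsymm.ae h] with z hz
    simpa using hz

end Product

end MeasuredGroup

theorem mainTheorem4 {G : Type*} [Group G] (μ : PMF G) (hμ : MeasuredGroup.IsMeasuredGroup μ)
    {B : Type*} [MeasurableSpace B] [MulAction G B] (m : Measure B)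
    (hm : MeasuredGroup.IsPoissonBoundary μ m)
    {B' : Type*} [MeasurableSpace B'] [MulAction G B'] (m' : Measure B')
    (hm' : MeasuredGroup.IsPoissonBoundary (MeasuredGroup.reflect μ) m') :
    (∀ (Y : Type*) [MeasurableSpace Y] [MulAction G Y] [MeasurableConstSMul G Y]
      (η : Measure Y) [IsProbabilityMeasure η] [ErgodicSMul G Y η],
      MeasuredGroup.IsErgodicAction G (m.prod (m'.prod η))) ∧
    (∀ (H : Type*) [NormedAddCommGroup H] [InnerProductSpace ℂ H] [CompleteSpace H]
      (π : G →* (H ≃ₗᵢ[ℂ] H)) (F : B × B' → H),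
      AEStronglyMeasurable F (m.prod m') →
      (∀ g : G, ∀ᵐ p ∂(m.prod m'), F (g • p) = π g (F p)) →
      ∃ c : H, ∀ᵐ p ∂(m.prod m'), F p = c) :=
  ⟨fun _ _ _ _ η _ _ => MeasuredGroup.isErgodicAction_prod hμ hm hm' η,
    fun _ _ _ _ π _ hF hπ => MeasuredGroup.ae_eq_const_of_equivariant hμ hm hm' π hF hπ⟩
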